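/- Let $X$ be a $T_1$ topological space, and let $X_{top}$ be the poset of open subsets of $X$, regarded as a category. A *topological étale groupoid over $X$* is a groupoid with object set $X$ and a topological space $\mathcal G_1$ of arrows such that the identities, inversion and composition maps are continuous and the source map $s$ and the target map $t$ are local homeomorphisms $\mathcal G_1\to X$. A morphism of étale groupoids over $X$ is a continuous functor that is the identity on $X$. Let $\mathcal C$ be a small category with $Ob(\mathcal C)=Ob(X_{top})$ together with an embedding $X_{top}\subset\mathcal C$ that is the identity on objects. For $V\in X_{top}$, restricting along $X_{top}\subset\mathcal C$ gives a presheaf of sets $\mathcal C(-,V)$ on $X$. Let $\mathcal C_x(V)=\varinjlim_{U\ni x}\mathcal C(U,V)$ be its stalk at $x\in X$, and let $\mathcal C_x^y=\varprojlim_{V\ni y}\mathcal C_x(V)$ for $x,y\in X$. Composition in $\mathcal C$ induces maps $\mathcal C_y^z\times\mathcal C_x^y\to\mathcal C_x^z$, and so a category $\mathcal C^\star$ with object set $X$ and $\mathcal C^\star(x,y)=\mathcal C_x^y$. Such a $\mathcal C$ is a *pseudogroup sheaf on $X$* if 1. for every $x\in X$ and every $V\in X_{top}$, the projections $\mathcal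 C_x^y\to\mathcal C_x(V)$, $y\in V$, together form a bijection $\coprod_{y\in V}\mathcal C_x^y\to\mathcal C_x(V)$; 2. the category $\mathcal C^\star$ is a groupoid; 3. for every $V\in X_{top}$ the presheaf $\mathcal C(-,V)$ is a sheaf. A morphism $\mathcal C\to\mathcal D$ of pseudogroup sheaves is a functor that fixes $X_{top}$, i.e. one whose composite with $X_{top}\subset\mathcal C$ is $X_{top}\subset\mathcal D$. For a topological étale groupoid $\mathcal G$ over $X$, let $\hat{\mathcal G}$ be the category with object set $Ob(X_{top})$ in which $\hat{\mathcal G}(U,V)$ is the set of continuous maps $f:U\to t^{-1}(V)\subset\mathcal G_1$ with $s\circ f=\mathrm{id}_U$, the composite of $f\in\hat{\mathcal G}(U,V)$ and $g\in\hat{\mathcal G}(V,W)$ is $x\mapsto g(t(f(x)))\circ f(x)$, and an inclusion $U\subset V$ corresponds to the restriction to $U$ of the identities map of $\mathcal G$. **Theorem.** The category of topological étale groupoids over $X$ is equivalent to the category of pseudogroup sheaves on $X$. The equivalence can be chosen so that, up to natural isomorphism, it sends $\mathcal G$ to $\hat{\mathcal G}$, and a morphism $\varphi$ to the functor $f\mapsto\varphi\circ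 f$. -/

import Mathlib

open CategoryTheory TopologicalSpace Opposite

universe u

/-! ### Topological étale groupoids over a space -/

/-- A topological étale groupoid whose space of objects is `X`: a groupoid with object set `X` and
a topological space `Arr` of arrows, all of whose structure maps are continuous and whose source and
target maps are local homeomorphisms (in particular continuous). The composite `mul g f h` is
`g ∘ f`, defined when the source of `g` is the target of `f`. -/
structure EtaleGroupoid (X : TopCat.{u}) where
  Arr : Type u
  [topArr : TopologicalSpace Arr]
  src : Arr → X
  tgt : Arr → X
  one : X → Arr
  inv : Arr → Arr
  mul : ∀ g f : Arr, src g = tgt f → Arr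
  src_one : ∀ x, src (one x) = x
  tgt_one : ∀ x, tgt (one x) = x
  src_inv : ∀ f, src (inv f) = tgt f
  tgt_inv : ∀ f, tgt (inv f) = src f
  src_mul : ∀ g f h, src (mul g f h) = src f
  tgt_mul : ∀ g f h, tgt (mul g f h) = tgt g
  mul_one : ∀ f, mul f (one (src f)) (tgt_one (src f)).symm = f
  one_mul : ∀ f, mul (one (tgt f)) f (src_one (tgt f)) = f
  mul_assoc : ∀ k g f (h₁ : src k = tgt g) (h₂ : src g = tgt f),
    mul (mul k g h₁) f ((src_mul k g h₁).trans h₂) =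
      mul k (mul g f h₂) (h₁.trans (tgt_mul g f h₂).symm)
  inv_mul : ∀ f, mul (inv f) f (src_inv f) = one (src f)
  mul_inv : ∀ f, mul f (inv f) (tgt_inv f).symm = one (tgt f)
  src_isLocalHomeomorph : IsLocalHomeomorph src
  tgt_isLocalHomeomorph : IsLocalHomeomorph tgt
  continuous_one : Continuous one
  continuous_inv : Continuous inv
  continuous_mul : Continuous fun p : {p : Arr × Arr // src p.1 = tgt p.2} => mul p.1.1 p.1.2 p.2

namespace EtaleGroupoid

variable {X : TopCat.{u}}

attribute [instance] EtaleGroupoid.topArr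

/-- A morphism of étale groupoids over `X`: a continuous functor which is the identity on `X`. -/
@[ext]
structure Hom (G H : EtaleGroupoid X) where
  toFun : G.Arr → H.Arr
  continuous_toFun : Continuous toFun
  src_toFun : ∀ f, H.src (toFun f) = G.src f
  tgt_toFun : ∀ f, H.tgt (toFun f) = G.tgt f
  toFun_one : ∀ x, toFun (G.one x) = H.one x
  toFun_mul : ∀ g f (h : G.src g = G.tgt f), toFun (G.mul g f h) =
    H.mul (toFun g) (toFun f) ((src_toFun g).trans (h.trans (tgt_toFun f).symm))

/-- The category of topological étale groupoids over `X`. -/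
instance : Category (EtaleGroupoid X) where
  Hom := Hom
  id G := ⟨id, continuous_id, fun _ => rfl, fun _ => rfl, fun _ => rfl, fun _ _ _ => rfl⟩
  comp φ ψ :=
    { toFun := ψ.toFun ∘ φ.toFun
      continuous_toFun := ψ.continuous_toFun.comp φ.continuous_toFun
      src_toFun := fun f => (ψ.src_toFun _).trans (φ.src_toFun f)
      tgt_toFun := fun f => (ψ.tgt_toFun _).trans (φ.tgt_toFun f)
      toFun_one := fun x => by simp only [Function.comp_apply, φ.toFun_one, ψ.toFun_one]
      toFun_mul := fun g f h => by simp only [Function.comp_apply, φ.toFun_mul, ψ.toFun_mul] }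
  id_comp _ := rfl
  comp_id _ := rfl
  assoc _ _ _ := rfl

end EtaleGroupoid

/-! ### Categories whose objects are the open sets, containing the poset of open sets -/

/-- A small category with object set the open subsets of `X`, together with an identity-on-objects
functor `incl` from the poset `Opens X`. (Such a functor is automatically an embedding, since there
is at most one morphism `U ⟶ V` in `Opens X`.) Composition is in diagrammatic order:
`comp f g` is `g ∘ f`. -/
structure OpensCat (X : TopCat.{u}) where
  Hom : Opens X → Opens X → Type u
  id : ∀ U, Hom U U
  comp : ∀ {U V W}, Hom U V → Hom V W → Hom U W
  id_comp : ∀ {U V} (f : Hom U V), comp (id U) f = f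
  comp_id : ∀ {U V} (f : Hom U V), comp f (id V) = f
  assoc : ∀ {U V W Z} (f : Hom U V) (g : Hom V W) (h : Hom W Z),
    comp (comp f g) h = comp f (comp g h)
  incl : ∀ {U V : Opens X}, U ≤ V → Hom U V
  incl_refl : ∀ U, incl (le_refl U) = id U
  incl_trans : ∀ {U V W : Opens X} (h : U ≤ V) (k : V ≤ W),
    incl (h.trans k) = comp (incl h) (incl k)

namespace OpensCat

variable {X : TopCat.{u}}

/-- A morphism `C ⟶ D`: a functor which fixes `Opens X`, that is, which is the identity on objects
and carries inclusions to inclusions. -/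
@[ext]
structure Fun (C D : OpensCat X) where
  map : ∀ {U V}, C.Hom U V → D.Hom U V
  map_id : ∀ U, map (C.id U) = D.id U
  map_comp : ∀ {U V W} (f : C.Hom U V) (g : C.Hom V W), map (C.comp f g) = D.comp (map f) (map g)
  map_incl : ∀ {U V : Opens X} (h : U ≤ V), map (C.incl h) = D.incl h

instance : Category (OpensCat X) where
  Hom := Fun
  id C := ⟨fun f => f, fun _ => rfl, fun _ _ => rfl, fun _ => rfl⟩
  comp F G :=
    { map := fun f => G.map (F.map f)
      map_id := fun U => by simp only [F.map_id, G.map_id]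
      map_comp := fun f g => by simp only [F.map_comp, G.map_comp]
      map_incl := fun h => by simp only [F.map_incl, G.map_incl] }
  id_comp _ := rfl
  comp_id _ := rfl
  assoc _ _ _ := rfl

variable (C : OpensCat X)

/-- The presheaf of sets `C(-, V)` on `X`: restriction along `U' ≤ U` is precomposition with the
inclusion of `U'` in `U`. -/
def presheaf (V : Opens X) : X.Presheaf (Type u) where
  obj U := C.Hom U.unop V
  map i := ↾fun f => C.comp (C.incl i.unop.le) f
  map_id U := by
    ext f
    exact (congrArg (fun j => C.comp j f) (C.incl_refl U.unop)).trans (C.id_comp f)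
  map_comp i j := by
    ext f
    exact (congrArg (fun k => C.comp k f) (C.incl_trans j.unop.le i.unop.le)).trans (C.assoc _ _ f)

/-- Composition with `g : V ⟶ W`, as a morphism of presheaves `C(-, V) ⟶ C(-, W)`. -/
def postcomp {V W : Opens X} (g : C.Hom V W) : C.presheaf V ⟶ C.presheaf W where
  app _ := ↾fun f => C.comp f g
  naturality _ _ i := by
    ext f
    exact C.assoc _ f g

/-- The set `C_x(V)`: the stalk at `x` of the presheaf `C(-, V)`. -/
noncomputable def Stalk (x : X) (V : Opens X) : Type u :=
  (C.presheaf V).stalk x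

/-- The germ at `x`, in `C_x(V)`, of a morphism `f : U ⟶ V` of `C` with `x ∈ U`. -/
noncomputable def germ {U V : Opens X} (x : X) (hx : x ∈ U) (f : C.Hom U V) : C.Stalk x V :=
  (C.presheaf V).germ U x hx f

/-- The map `C_x(V) → C_x(W)` induced by composition with `g : V ⟶ W`. -/
noncomputable def stalkMap {V W : Opens X} (x : X) (g : C.Hom V W) : C.Stalk x V → C.Stalk x W :=
  fun s => (TopCat.Presheaf.stalkFunctor (Type u) x).map (C.postcomp g) s

theorem exists_germ {x : X} {V : Opens X} (s : C.Stalk x V) :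
    ∃ (U : Opens X) (hx : x ∈ U) (f : C.Hom U V), C.germ x hx f = s :=
  TopCat.Presheaf.exists_germ_eq (C.presheaf V) s

theorem germ_incl_comp {U U' V : Opens X} (h : U' ≤ U) {x : X} (hx : x ∈ U') (f : C.Hom U V) :
    C.germ x hx (C.comp (C.incl h) f) = C.germ x (h hx) f :=
  TopCat.Presheaf.germ_res_apply (C.presheaf V) (homOfLE h) x hx f

theorem stalkMap_germ {U V W : Opens X} {x : X} (hx : x ∈ U) (f : C.Hom U V) (g : C.Hom V W) :
    C.stalkMap x g (C.germ x hx f) = C.germ x hx (C.comp f g) :=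
  TopCat.Presheaf.stalkFunctor_map_germ_apply U x hx (C.postcomp g) f

theorem stalkMap_id {V : Opens X} {x : X} (s : C.Stalk x V) : C.stalkMap x (C.id V) s = s := by
  obtain ⟨U, hx, f, rfl⟩ := C.exists_germ s
  rw [stalkMap_germ, C.comp_id]

theorem stalkMap_comp {V W Z : Opens X} {x : X} (g : C.Hom V W) (k : C.Hom W Z)
    (s : C.Stalk x V) : C.stalkMap x (C.comp g k) s = C.stalkMap x k (C.stalkMap x g s) := by
  obtain ⟨U, hx, f, rfl⟩ := C.exists_germ s
  rw [stalkMap_germ, stalkMap_germ, stalkMap_germ, C.assoc]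

/-- The set `C_x^y`: the inverse limit of the sets `C_x(V)` over the open neighbourhoods `V` of
`y`, realised as the set of compatible families. The map `proj V : C_x^y → C_x(V)` is the natural
projection. -/
@[ext]
structure StarHom (x y : X) : Type u where
  proj : ∀ V : Opens X, y ∈ V → C.Stalk x V
  map_proj : ∀ {V W : Opens X} (h : V ≤ W) (hV : y ∈ V),
    C.stalkMap x (C.incl h) (proj V hV) = proj W (h hV)

variable {C}

/-- Precomposition with `a ∈ C_x^y`, as a map `C_y(W) → C_x(W)`: it carries the germ at `y` of
`g : V ⟶ W` to the image under `g` of the component of `a` in `C_x(V)`. -/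
noncomputable def StarHom.precomp {x y : X} (a : C.StarHom x y) (W : Opens X) :
    C.Stalk y W → C.Stalk x W :=
  fun s => Limits.colimit.desc ((OpenNhds.inclusion y).op ⋙ C.presheaf W)
    { pt := C.Stalk x W
      ι :=
        { app := fun V => ↾fun g : C.Hom V.unop.1 W => C.stalkMap x g (a.proj V.unop.1 V.unop.2)
          naturality := by
            intro V V' h
            ext g
            refine (C.stalkMap_comp (C.incl h.unop.le) g _).trans ?_
            exact congrArg (C.stalkMap x g) (a.map_proj h.unop.le V'.unop.2) } } s

theorem StarHom.precomp_germ {x y : X} (a : C.StarHom x y) {V W : Opens X} (hV : y ∈ V)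
    (g : C.Hom V W) : a.precomp W (C.germ y hV g) = C.stalkMap x g (a.proj V hV) :=
  ConcreteCategory.congr_hom (Limits.colimit.ι_desc
    (F := (OpenNhds.inclusion y).op ⋙ C.presheaf W) _ (op (⟨V, hV⟩ : OpenNhds y))) g

theorem StarHom.precomp_stalkMap {x y : X} (a : C.StarHom x y) {W Z : Opens X} (g : C.Hom W Z)
    (s : C.Stalk y W) : a.precomp Z (C.stalkMap y g s) = C.stalkMap x g (a.precomp W s) := by
  obtain ⟨V, hV, f, rfl⟩ := C.exists_germ s
  rw [stalkMap_germ, precomp_germ, precomp_germ, stalkMap_comp]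

/-- The identity of `x`: the family of germs at `x` of the identities of the open neighbourhoods
of `x`. -/
noncomputable def StarHom.id (x : X) : C.StarHom x x where
  proj V hV := C.germ x hV (C.id V)
  map_proj {V W} h hV := by
    rw [stalkMap_germ, C.id_comp, ← C.germ_incl_comp h hV, C.comp_id]

/-- The composite of `a ∈ C_x^y` and `b ∈ C_y^z`: if `b` is represented in `C_y(W)` by
`g : V ⟶ W`, and `a` is represented in `C_x(V)` by `f : U ⟶ V`, then the composite is represented
in `C_x(W)` by `g ∘ f`. -/
noncomputable def StarHom.comp {x y z : X} (a : C.StarHom x y) (b : C.StarHom y z) :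
    C.StarHom x z where
  proj W hW := a.precomp W (b.proj W hW)
  map_proj {V W} h hV := by
    rw [← precomp_stalkMap, b.map_proj]

theorem StarHom.id_comp {x y : X} (a : C.StarHom x y) : (StarHom.id x).comp a = a := by
  refine StarHom.ext (funext fun V => funext fun hV => ?_)
  obtain ⟨U, hx, f, hf⟩ := C.exists_germ (a.proj V hV)
  change (StarHom.id x).precomp V (a.proj V hV) = a.proj V hV
  rw [← hf, precomp_germ]
  exact (C.stalkMap_germ hx (C.id U) f).trans (by rw [C.id_comp])

theorem StarHom.comp_id {x y : X} (a : C.StarHom x y) : a.comp (StarHom.id y) = a := by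
  refine StarHom.ext (funext fun V => funext fun hV => ?_)
  exact (a.precomp_germ hV (C.id V)).trans (C.stalkMap_id _)

theorem StarHom.assoc {w x y z : X} (a : C.StarHom w x) (b : C.StarHom x y) (c : C.StarHom y z) :
    (a.comp b).comp c = a.comp (b.comp c) := by
  refine StarHom.ext (funext fun V => funext fun hV => ?_)
  obtain ⟨U, hU, f, hf⟩ := C.exists_germ (c.proj V hV)
  change (a.comp b).precomp V (c.proj V hV) = a.precomp V (b.precomp V (c.proj V hV))
  rw [← hf, precomp_germ, precomp_germ, precomp_stalkMap]
  rfl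

variable (C)

/-- The set of objects of the category `C*`: the points of `X`. -/
def Star (_ : OpensCat X) : Type u := X

/-- The category `C*`: its objects are the points of `X`, its morphisms `x ⟶ y` are the elements
of `C_x^y`, and its composition is induced by that of `C`. -/
noncomputable instance : Category C.Star where
  Hom x y := C.StarHom x y
  id x := StarHom.id x
  comp a b := a.comp b
  id_comp a := a.id_comp
  comp_id a := a.comp_id
  assoc a b c := a.assoc b c

/-- `C` is a pre-pseudogroup: for every point `x` and every open `V`, the projections
`C_x^y → C_x(V)`, `y ∈ V`, exhibit `C_x(V)` as the disjoint union of the `C_x^y`, and the category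
`C*` is a groupoid. -/
structure IsPrePseudogroup : Prop where
  bijective_proj : ∀ (x : X) (V : Opens X),
    Function.Bijective fun p : Σ y : V, C.StarHom x y.1 => p.2.proj V p.1.2
  isGroupoid : IsGroupoid C.Star

/-- `C` is a pseudogroup sheaf: a pre-pseudogroup such that the presheaf `C(-, V)` is a sheaf for
every open `V`. -/
structure IsPseudogroupSheaf : Prop extends C.IsPrePseudogroup where
  isSheaf : ∀ V : Opens X, (C.presheaf V).IsSheaf

end OpensCat

/-- The property of being a pseudogroup sheaf on `X`. -/
def pseudogroupSheafProperty (X : TopCat.{u}) : ObjectProperty (OpensCat X) :=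
  OpensCat.IsPseudogroupSheaf

/-- The category of pseudogroup sheaves on `X`; its morphisms are the functors fixing
`Opens X`. -/
abbrev PseudogroupSheaf (X : TopCat.{u}) := (pseudogroupSheafProperty X).FullSubcategory

/-! ### Local sections of the source map -/

namespace EtaleGroupoid

variable {X : TopCat.{u}}

/-- A continuous section over `U` of the source map of `G`, with targets in `V`. -/
@[ext]
structure LocalSection (G : EtaleGroupoid X) (U V : Opens X) where
  toFun : U → G.Arr
  continuous_toFun : Continuous toFun
  src_toFun : ∀ x, G.src (toFun x) = x
  tgt_mem : ∀ x, G.tgt (toFun x) ∈ V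

/-- The category of local sections of `G`: a morphism `U ⟶ V` is a continuous section over `U` of
the source map with targets in `V`, and `g ∘ f` is `x ↦ g (t (f x)) * f x`. An inclusion `U ≤ V`
gives the restriction to `U` of the identities map. -/
def localSections (G : EtaleGroupoid X) : OpensCat X where
  Hom := G.LocalSection
  id U := ⟨fun x => G.one x, G.continuous_one.comp continuous_subtype_val,
    fun x => G.src_one x, fun x => by rw [G.tgt_one]; exact x.2⟩
  comp {U V W} f g :=
    { toFun := fun x =>
        G.mul (g.toFun ⟨G.tgt (f.toFun x), f.tgt_mem x⟩) (f.toFun x) (g.src_toFun _)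
      continuous_toFun := by
        have h : Continuous fun x : U =>
            (⟨(g.toFun ⟨G.tgt (f.toFun x), f.tgt_mem x⟩, f.toFun x), g.src_toFun _⟩ :
              {p : G.Arr × G.Arr // G.src p.1 = G.tgt p.2}) :=
          ((g.continuous_toFun.comp ((G.tgt_isLocalHomeomorph.continuous.comp
            f.continuous_toFun).subtype_mk _)).prodMk f.continuous_toFun).subtype_mk _
        exact G.continuous_mul.comp h
      src_toFun := fun x => (G.src_mul _ _ _).trans (f.src_toFun x)
      tgt_mem := fun x => by rw [G.tgt_mul]; exact g.tgt_mem _ }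
  id_comp {U V} f := by
    refine LocalSection.ext (funext fun x => ?_)
    have key : ∀ (y : U) (h : G.src (f.toFun y) = G.tgt (G.one x)), y = x →
        G.mul (f.toFun y) (G.one x) h = f.toFun x := by
      rintro y h rfl
      have h' : (y : X) = G.src (f.toFun y) := (f.src_toFun y).symm
      have key2 : ∀ (z : X) (hz : G.src (f.toFun y) = G.tgt (G.one z)),
          z = G.src (f.toFun y) → G.mul (f.toFun y) (G.one z) hz = f.toFun y := by
        rintro z hz rfl
        exact G.mul_one _
      exact key2 _ h h'
    exact key _ _ (Subtype.ext (G.tgt_one x))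
  comp_id f := LocalSection.ext (funext fun x => G.one_mul (f.toFun x))
  assoc f g h := by
    refine LocalSection.ext (funext fun x => ?_)
    simp only [G.tgt_mul]
    exact (G.mul_assoc _ _ _ _ _).symm
  incl {U V} h := ⟨fun x => G.one x, G.continuous_one.comp continuous_subtype_val,
    fun x => G.src_one x, fun x => by rw [G.tgt_one]; exact h x.2⟩
  incl_refl _ := rfl
  incl_trans {U V W} h k := by
    refine LocalSection.ext (funext fun x => ?_)
    have key : ∀ (y : X) (hy : G.src (G.one y) = G.tgt (G.one x)), y = G.tgt (G.one x) →
        G.mul (G.one y) (G.one x) hy = G.one x := by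
      rintro y hy rfl
      exact G.one_mul _
    exact (key _ _ rfl).symm

/-- The functor sending an étale groupoid over `X` to its category of local sections, and a
morphism `φ` to composition of sections with `φ`. -/
def localSectionsFunctor (X : TopCat.{u}) : EtaleGroupoid X ⥤ OpensCat X where
  obj G := G.localSections
  map {G H} φ :=
    { map := fun f =>
        { toFun := fun x => φ.toFun (f.toFun x)
          continuous_toFun := φ.continuous_toFun.comp f.continuous_toFun
          src_toFun := fun x => (φ.src_toFun _).trans (f.src_toFun x)
          tgt_mem := fun x => by rw [φ.tgt_toFun]; exact f.tgt_mem x }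
      map_id := fun U => LocalSection.ext (funext fun x => φ.toFun_one x)
      map_comp := fun f g => by
        refine LocalSection.ext (funext fun x => ?_)
        refine (φ.toFun_mul _ _ _).trans ?_
        simp only [localSections, φ.tgt_toFun]
      map_incl := fun h => LocalSection.ext (funext fun x => φ.toFun_one x) }
  map_id _ := rfl
  map_comp _ _ := rfl

end EtaleGroupoid

/-! For a local homeomorphism `src`, a germ of sections at `x` is the same thing as a point of the
fibre over `x`. So the stalk at `x` of the sections of `G` with targets in `V` is the set of arrows
from `x` into `V` (`germ_eq_germ_iff`, `exists_stalkEval_eq`). In the limit over neighbourhoods of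
`y` the targets specialize to `y`, and T₁ forces them to equal `y` (`tgt_starEval`). Thus the star
category of the local sections is `G` without its topology, which gives the groupoid and coproduct
conditions; sections glue, which gives the sheaf condition.

Full faithfulness: a functor `Φ` fixing the open sets commutes with restriction, so the value of `Φ
f` at `x` depends only on the arrow `f x` (`map_apply_eq_of_apply_eq`). This defines the unique map
on arrows inducing `Φ`.

Essential surjectivity: the arrows of `C*` carry the topology generated by the sets of germs of
single morphisms, and form an étale groupoid (`germGroupoid`). Sending a morphism to its family of
germs maps `C` to the local sections of this groupoid, bijectively on morphisms because each `C(-,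
V)` is a sheaf (`toLocalSections_bijective`). -/

/-! ### Germs, gluing and isomorphisms for categories containing the open sets. -/

namespace OpensCat

variable {X : TopCat.{u}} {C D : OpensCat X}

theorem exists_incl_comp_eq_of_germ_eq {U U' V : Opens X} {x : X} {hx : x ∈ U} {hx' : x ∈ U'}
    {f : C.Hom U V} {f' : C.Hom U' V} (h : C.germ x hx f = C.germ x hx' f') :
    ∃ (W : Opens X) (_ : x ∈ W) (i : W ≤ U) (i' : W ≤ U'),
      C.comp (C.incl i) f = C.comp (C.incl i') f' := by
  obtain ⟨W, hW, i, i', e⟩ := (C.presheaf V).germ_eq x hx hx' f f' h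
  exact ⟨W, hW, i.le, i'.le, e⟩

theorem germ_eq_of_incl_comp_eq {U U' V W : Opens X} {x : X} (hW : x ∈ W) {i : W ≤ U} {i' : W ≤ U'}
    {f : C.Hom U V} {f' : C.Hom U' V} (h : C.comp (C.incl i) f = C.comp (C.incl i') f') :
    C.germ x (i hW) f = C.germ x (i' hW) f' := by
  rw [← C.germ_incl_comp i hW, ← C.germ_incl_comp i' hW, h]

theorem hom_ext_of_germ_eq {U V : Opens X} (hV : (C.presheaf V).IsSheaf) {f f' : C.Hom U V}
    (h : ∀ x (hx : x ∈ U), C.germ x hx f = C.germ x hx f') : f = f' :=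
  TopCat.Presheaf.section_ext ⟨C.presheaf V, hV⟩ U f f' h

theorem exists_gluing {U V : Opens X} (hV : (C.presheaf V).IsSheaf) {ι : Type u}
    (W : ι → Opens X) (hW : ∀ i, W i ≤ U) (hU : U ≤ iSup W) (f : ∀ i, C.Hom (W i) V)
    (h : ∀ i j, C.comp (C.incl (inf_le_left : W i ⊓ W j ≤ W i)) (f i) =
      C.comp (C.incl (inf_le_right : W i ⊓ W j ≤ W j)) (f j)) :
    ∃ g : C.Hom U V, ∀ i, C.comp (C.incl (hW i)) g = f i := by
  let F : TopCat.Sheaf (Type u) X := ⟨C.presheaf V, hV⟩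
  let sf (i : ι) : F.1.obj (op (W i)) := f i
  exact (F.existsUnique_gluing' W U (fun i => homOfLE (hW i)) hU sf fun i j => h i j).exists

/-- A functor fixing the open sets which is bijective on morphisms is an isomorphism. -/
noncomputable def isoOfBijective (F : C ⟶ D)
    (hF : ∀ U V, Function.Bijective (F.map : C.Hom U V → D.Hom U V)) : C ≅ D where
  hom := F
  inv :=
    { map := fun {U V} => (Equiv.ofBijective _ (hF U V)).symm
      map_id := fun U => by
        rw [Equiv.symm_apply_eq]
        exact (F.map_id U).symm
      map_comp := fun {U V W} f g => by
        rw [Equiv.symm_apply_eq]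
        refine Eq.trans ?_ (F.map_comp _ _).symm
        congr 1
        · exact ((Equiv.ofBijective _ (hF U V)).apply_symm_apply f).symm
        · exact ((Equiv.ofBijective _ (hF V W)).apply_symm_apply g).symm
      map_incl := fun h => by
        rw [Equiv.symm_apply_eq]
        exact (F.map_incl h).symm }
  hom_inv_id := Fun.ext (funext fun U => funext fun V => funext fun f =>
    (Equiv.ofBijective _ (hF U V)).symm_apply_apply f)
  inv_hom_id := Fun.ext (funext fun U => funext fun V => funext fun f =>
    (Equiv.ofBijective _ (hF U V)).apply_symm_apply f)

end OpensCat

/-! ### The local sections of an étale groupoid form a pseudogroup sheaf. -/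

namespace EtaleGroupoid

variable {X : TopCat.{u}} (G : EtaleGroupoid X)

theorem mul_congr {g g' f f' : G.Arr} (hg : g = g') (hf : f = f') (h : G.src g = G.tgt f) :
    G.mul g f h = G.mul g' f' (hg ▸ hf ▸ h) := by
  subst hg hf
  rfl

variable {G}

namespace LocalSection

theorem apply_congr {U V : Opens X} (f : G.LocalSection U V) {x y : U} (h : (x : X) = y) :
    f.toFun x = f.toFun y :=
  congrArg f.toFun (Subtype.ext h)

/-- The restriction of a local section to a smaller open set. -/
def restrict {U U' V : Opens X} (f : G.LocalSection U V) (h : U' ≤ U) : G.LocalSection U' V where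
  toFun x := f.toFun ⟨x, h x.2⟩
  continuous_toFun := f.continuous_toFun.comp (continuous_subtype_val.subtype_mk _)
  src_toFun _ := f.src_toFun _
  tgt_mem _ := f.tgt_mem _

theorem incl_comp {U U' V : Opens X} (h : U' ≤ U) (f : G.LocalSection U V) :
    G.localSections.comp (G.localSections.incl h) f = f.restrict h :=
  G.localSections.id_comp (f.restrict h)

theorem comp_incl_apply {U V V' : Opens X} (f : G.LocalSection U V) (h : V ≤ V') (x : U) :
    LocalSection.toFun (G.localSections.comp f (G.localSections.incl h)) x = f.toFun x :=
  G.one_mul (f.toFun x)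

/-- Both are sections of the locally injective map `src`, so they agree wherever both values lie in
a neighbourhood on which `src` is injective. -/
theorem exists_eqOn {U U' V V' : Opens X} (f : G.LocalSection U V) (f' : G.LocalSection U' V')
    {x : X} (hx : x ∈ U) (hx' : x ∈ U') (h : f.toFun ⟨x, hx⟩ = f'.toFun ⟨x, hx'⟩) :
    ∃ (W : Opens X) (_ : x ∈ W) (i : W ≤ U) (i' : W ≤ U'),
      ∀ y : W, f.toFun ⟨y, i y.2⟩ = f'.toFun ⟨y, i' y.2⟩ := by
  obtain ⟨O, hO, hxO, inj⟩ := G.src_isLocalHomeomorph.isLocallyInjective (f.toFun ⟨x, hx⟩)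
  let f₁ := f.restrict (inf_le_left : U ⊓ U' ≤ U)
  let f₂ := f'.restrict (inf_le_right : U ⊓ U' ≤ U')
  have ho : IsOpen (f₁.toFun ⁻¹' O ∩ f₂.toFun ⁻¹' O) :=
    (hO.preimage f₁.continuous_toFun).inter (hO.preimage f₂.continuous_toFun)
  refine ⟨⟨_, (U ⊓ U').isOpen.isOpenMap_subtype_val _ ho⟩,
    ⟨⟨x, hx, hx'⟩, ⟨hxO, ?_⟩, rfl⟩, ?_, ?_, ?_⟩
  · change f'.toFun _ ∈ O
    rw [← h]
    exact hxO
  · rintro _ ⟨y, -, rfl⟩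
    exact y.2.1
  · rintro _ ⟨y, -, rfl⟩
    exact y.2.2
  · rintro ⟨_, y, hy, rfl⟩
    exact inj hy.1 hy.2 
      ((f.src_toFun ⟨y, y.2.1⟩).trans (f'.src_toFun ⟨y, y.2.2⟩).symm)

end LocalSection

variable (G) in
-- The section is a local inverse of `src` through `a`, cut down to the open set where its targets
-- lie in `V`.
theorem exists_localSection {a : G.Arr} {x : X} (hx : G.src a = x) {V : Opens X}
    (hV : G.tgt a ∈ V) :
    ∃ (U : Opens X) (hU : x ∈ U) (f : G.LocalSection U V), f.toFun ⟨x, hU⟩ = a := by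
  obtain ⟨e, hae, he⟩ := G.src_isLocalHomeomorph a
  subst hx
  have hsa : e.symm (G.src a) = a := by rw [he]; exact e.left_inv hae
  refine ⟨⟨_, e.isOpen_inter_preimage_symm (V.isOpen.preimage G.tgt_isLocalHomeomorph.continuous)⟩,
    ⟨?_, ?_⟩, ⟨fun x => e.symm x, ?_, ?_, ?_⟩, hsa⟩
  · rw [he]
    exact e.map_source hae
  · change G.tgt (e.symm (G.src a)) ∈ V
    rwa [hsa]
  · exact (e.continuousOn_symm.mono Set.inter_subset_left).domRestrict
  · intro x
    rw [he]
    exact e.right_inv x.2.1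
  · exact fun x => x.2.2

section Stalk

variable {x y z : X} {U V W : Opens X}

theorem germ_eq_germ_iff {U' : Opens X} {hx : x ∈ U} {hx' : x ∈ U'} (f : G.LocalSection U V)
    (f' : G.LocalSection U' V) :
    G.localSections.germ x hx f = G.localSections.germ x hx' f' ↔
      f.toFun ⟨x, hx⟩ = f'.toFun ⟨x, hx'⟩ := by
  constructor
  · intro h
    obtain ⟨W, hW, i, i', e⟩ := OpensCat.exists_incl_comp_eq_of_germ_eq h
    rw [LocalSection.incl_comp, LocalSection.incl_comp] at e
    exact congrArg (fun k : G.LocalSection W V => k.toFun ⟨x, hW⟩) e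
  · intro h
    obtain ⟨W, hW, i, i', e⟩ := f.exists_eqOn f' hx hx' h
    refine OpensCat.germ_eq_of_incl_comp_eq hW (i := i) (i' := i') ?_
    rw [LocalSection.incl_comp, LocalSection.incl_comp]
    exact LocalSection.ext (funext e)

/-- The value at `x` of the germs at `x` of local sections. -/
noncomputable def stalkEval (s : G.localSections.Stalk x V) : G.Arr :=
  LocalSection.toFun (G.localSections.exists_germ s).choose_spec.choose_spec.choose
    ⟨x, (G.localSections.exists_germ s).choose_spec.choose⟩

theorem stalkEval_germ (hx : x ∈ U) (f : G.LocalSection U V) :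
    stalkEval (G.localSections.germ x hx f) = f.toFun ⟨x, hx⟩ :=
  (germ_eq_germ_iff _ _).1
    (G.localSections.exists_germ (G.localSections.germ x hx f)).choose_spec.choose_spec.choose_spec

theorem stalkEval_injective :
    Function.Injective (stalkEval : G.localSections.Stalk x V → G.Arr) := by
  intro s s' h
  obtain ⟨U, hU, f, rfl⟩ := G.localSections.exists_germ s
  obtain ⟨U', hU', f', rfl⟩ := G.localSections.exists_germ s'
  rw [stalkEval_germ hU f, stalkEval_germ hU' f'] at h
  exact (germ_eq_germ_iff f f').2 h

theorem src_stalkEval (s : G.localSections.Stalk x V) : G.src (stalkEval s) = x :=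
  LocalSection.src_toFun _ _

theorem tgt_stalkEval_mem (s : G.localSections.Stalk x V) : G.tgt (stalkEval s) ∈ V :=
  LocalSection.tgt_mem _ _

theorem exists_stalkEval_eq {a : G.Arr} (hx : G.src a = x) (hV : G.tgt a ∈ V) :
    ∃ s : G.localSections.Stalk x V, stalkEval s = a := by
  obtain ⟨U, hU, f, rfl⟩ := G.exists_localSection hx hV
  exact ⟨_, stalkEval_germ hU f⟩

theorem stalkEval_stalkMap (g : G.LocalSection V W) (s : G.localSections.Stalk x V) :
    stalkEval (G.localSections.stalkMap x g s) =
      G.mul (g.toFun ⟨G.tgt (stalkEval s), tgt_stalkEval_mem s⟩) (stalkEval s)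
        (g.src_toFun _) := by
  obtain ⟨U, hU, f, rfl⟩ := G.localSections.exists_germ s
  refine (congrArg stalkEval (G.localSections.stalkMap_germ hU f g)).trans ?_
  refine (stalkEval_germ hU (G.localSections.comp f g)).trans ?_
  refine G.mul_congr (g.apply_congr ?_) (stalkEval_germ hU f).symm _
  exact congrArg G.tgt (stalkEval_germ hU f).symm

theorem stalkEval_stalkMap_incl (h : V ≤ W) (s : G.localSections.Stalk x V) :
    stalkEval (G.localSections.stalkMap x (G.localSections.incl h) s) = stalkEval s :=
  (stalkEval_stalkMap _ s).trans (G.one_mul _)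

/-- The arrow of `G` determined by an element of `C_x^y`, for `C` the category of local sections
of `G`. -/
noncomputable def starEval (a : G.localSections.StarHom x y) : G.Arr :=
  stalkEval (a.proj ⊤ trivial)

/-- The transition maps of the limit do not change the arrow, so the choice of `⊤` in `starEval` is
immaterial. -/
theorem stalkEval_proj (a : G.localSections.StarHom x y) (hV : y ∈ V) :
    stalkEval (a.proj V hV) = starEval a := by
  rw [starEval, ← a.map_proj le_top hV, stalkEval_stalkMap_incl]

theorem src_starEval (a : G.localSections.StarHom x y) : G.src (starEval a) = x :=
  src_stalkEval _

/-- Computing the arrow in `V` shows that its target lies in every open `V` containing `y`, hence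
specializes to `y`; T₁ turns this into equality. -/
theorem tgt_starEval [T1Space X] (a : G.localSections.StarHom x y) : G.tgt (starEval a) = y := by
  refine Specializes.eq (specializes_iff_forall_open.2 fun O hO hy => ?_)
  · rw [← stalkEval_proj a (V := ⟨O, hO⟩) hy]
    exact tgt_stalkEval_mem (a.proj ⟨O, hO⟩ hy)

theorem starEval_injective :
    Function.Injective (starEval : G.localSections.StarHom x y → G.Arr) := by
  intro a b h
  refine OpensCat.StarHom.ext (funext fun V => funext fun hV => stalkEval_injective ?_)
  rw [stalkEval_proj, stalkEval_proj, h]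

theorem exists_starEval_eq {a : G.Arr} (hx : G.src a = x) (hy : G.tgt a = y) :
    ∃ b : G.localSections.StarHom x y, starEval b = a := by
  choose s hs using fun (V : Opens X) (hV : y ∈ V) =>
    exists_stalkEval_eq hx (show G.tgt a ∈ V from hy ▸ hV)
  refine ⟨⟨s, fun {V W} h hV => stalkEval_injective ?_⟩, hs _ _⟩
  rw [stalkEval_stalkMap_incl, hs, hs]

theorem starEval_id : starEval (OpensCat.StarHom.id x : G.localSections.StarHom x x) = G.one x :=
  stalkEval_germ _ (G.localSections.id ⊤)

theorem starEval_comp [T1Space X] (a : G.localSections.StarHom x y)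
    (b : G.localSections.StarHom y z) :
    starEval (a.comp b) = G.mul (starEval b) (starEval a)
      ((src_starEval b).trans (tgt_starEval a).symm) := by
  -- A section `f` over a neighbourhood `U` of `y` represents `b`; the composite is then read off
  -- from the component of `a` at `U`.
  obtain ⟨U, hU, f, hf⟩ := G.localSections.exists_germ (b.proj ⊤ trivial)
  have hb : f.toFun ⟨y, hU⟩ = starEval b := by
    rw [starEval, ← hf]
    exact (stalkEval_germ hU f).symm
  change stalkEval (a.precomp ⊤ (b.proj ⊤ trivial)) = _
  rw [← hf, OpensCat.StarHom.precomp_germ]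
  refine (stalkEval_stalkMap f _).trans (G.mul_congr ?_ (stalkEval_proj a hU) _)
  rw [← hb]
  exact f.apply_congr ((congrArg G.tgt (stalkEval_proj a hU)).trans (tgt_starEval a))

end Stalk

/-- The index `y` is recovered as the target of the arrow. -/
theorem bijective_proj_localSections [T1Space X] (x : X) (V : Opens X) :
    Function.Bijective fun p : Σ y : V, G.localSections.StarHom x y.1 => p.2.proj V p.1.2 := by
  constructor
  · rintro ⟨⟨y, hy⟩, a⟩ ⟨⟨y', hy'⟩, a'⟩ h
    have h' : starEval a = starEval a' := by
      rw [← stalkEval_proj a hy, ← stalkEval_proj a' hy']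
      exact congrArg stalkEval h
    obtain rfl : y = y' := (tgt_starEval a).symm.trans ((congrArg G.tgt h').trans (tgt_starEval a'))
    rw [starEval_injective h']
  · intro s
    obtain ⟨b, hb⟩ := exists_starEval_eq (src_stalkEval s) rfl
    refine ⟨⟨⟨_, tgt_stalkEval_mem s⟩, b⟩, stalkEval_injective ?_⟩
    exact (stalkEval_proj b _).trans hb

theorem isGroupoid_star_localSections [T1Space X] : IsGroupoid G.localSections.Star where
  all_isIso {x y} a := by
    obtain ⟨b, hb⟩ := exists_starEval_eq (G := G) (a := G.inv (starEval a)) (x := y) (y := x)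
      ((G.src_inv _).trans (tgt_starEval a)) ((G.tgt_inv _).trans (src_starEval a))
    refine ⟨b, starEval_injective ?_, starEval_injective ?_⟩
    · refine (starEval_comp a b).trans ((G.mul_congr hb rfl _).trans
        ((G.inv_mul (starEval a)).trans ?_))
      exact (congrArg G.one (src_starEval a)).trans starEval_id.symm
    · refine (starEval_comp b a).trans ((G.mul_congr rfl hb _).trans
        ((G.mul_inv (starEval a)).trans ?_))
      exact (congrArg G.one (tgt_starEval a)).trans starEval_id.symm

theorem isSheaf_presheaf_localSections (V : Opens X) : (G.localSections.presheaf V).IsSheaf := by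
  refine TopCat.Presheaf.isSheaf_of_isSheafUniqueGluing_types _ fun ι U sf h => ?_
  let s : ∀ i, G.LocalSection (U i) V := sf
  have hs (i j : ι) (x : X) (hi : x ∈ U i) (hj : x ∈ U j) :
      (s i).toFun ⟨x, hi⟩ = (s j).toFun ⟨x, hj⟩ := by
    have e : (s i).restrict (inf_le_left : U i ⊓ U j ≤ U i) =
        (s j).restrict (inf_le_right : U i ⊓ U j ≤ U j) := by
      rw [← LocalSection.incl_comp, ← LocalSection.incl_comp]
      exact h i j
    exact congrArg (fun k : G.LocalSection (U i ⊓ U j) V => k.toFun ⟨x, hi, hj⟩) e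
  -- The glued section uses an arbitrary index at each point. By `hs` it coincides on `U (i x)` with
  -- `s (i x)`, whence its continuity.
  choose i hi using fun x : (iSup U : Opens X) => Opens.mem_iSup.1 x.2
  let t : G.LocalSection (iSup U) V :=
    { toFun := fun x => (s (i x)).toFun ⟨x, hi x⟩
      continuous_toFun := by
        refine continuous_iff_continuousAt.2 fun x => ?_
        have hc : ContinuousOn (fun y : (iSup U : Opens X) => (s (i y)).toFun ⟨y, hi y⟩)
            (Subtype.val ⁻¹' (U (i x) : Set X)) := by
          rw [continuousOn_iff_continuous_domRestrict]
          refine ((s (i x)).continuous_toFun.comp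
            ((continuous_subtype_val.comp continuous_subtype_val).subtype_mk
              fun y => y.2)).congr fun y => ?_
          exact hs _ _ _ _ _
        exact hc.continuousAt (((U (i x)).isOpen.preimage continuous_subtype_val).mem_nhds (hi x))
      src_toFun := fun x => (s (i x)).src_toFun _
      tgt_mem := fun x => (s (i x)).tgt_mem _ }
  refine ⟨t, fun j => ?_, fun t' ht' => ?_⟩
  · exact (LocalSection.incl_comp _ t).trans
      (LocalSection.ext (funext fun x => hs _ _ _ _ _))
  · refine LocalSection.ext (funext fun x => ?_)
    have e : LocalSection.restrict t' (le_iSup U (i x)) = s (i x) :=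
      (LocalSection.incl_comp _ t').symm.trans (ht' (i x))
    exact congrArg (fun k : G.LocalSection (U (i x)) V => k.toFun ⟨x, hi x⟩) e

variable (G) in
theorem isPseudogroupSheaf_localSections [T1Space X] : G.localSections.IsPseudogroupSheaf where
  bijective_proj := bijective_proj_localSections
  isGroupoid := isGroupoid_star_localSections
  isSheaf := isSheaf_presheaf_localSections

end EtaleGroupoid

/-! ### Full faithfulness of the local sections functor. -/

namespace EtaleGroupoid

variable {X : TopCat.{u}} {G H : EtaleGroupoid X}

theorem exists_localSection_apply_eq (a : G.Arr) {V : Opens X} (hV : G.tgt a ∈ V) :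
    ∃ (U : Opens X) (f : G.LocalSection U V) (x : U), f.toFun x = a := by
  obtain ⟨U, hU, f, hf⟩ := G.exists_localSection rfl hV
  exact ⟨U, f, ⟨_, hU⟩, hf⟩

section Functor

variable (Φ : OpensCat.Fun G.localSections H.localSections) {U U' V V' : Opens X}

/-- Restriction is composition with an inclusion, and `Φ` fixes inclusions. -/
theorem map_restrict (f : G.LocalSection U V) (h : U' ≤ U) :
    Φ.map (f.restrict h) = LocalSection.restrict (Φ.map f) h := by
  refine (congrArg Φ.map (LocalSection.incl_comp h f).symm).trans ?_
  refine (Φ.map_comp (G.localSections.incl h) f).trans ?_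
  rw [Φ.map_incl]
  exact LocalSection.incl_comp h (Φ.map f)

theorem map_comp_incl_apply (f : G.LocalSection U V) (h : V ≤ V') (x : U) :
    LocalSection.toFun (Φ.map (G.localSections.comp f (G.localSections.incl h))) x =
      LocalSection.toFun (Φ.map f) x := by
  refine (congrArg (fun k => LocalSection.toFun k x) (Φ.map_comp f _)).trans ?_
  rw [Φ.map_incl]
  exact LocalSection.comp_incl_apply _ _ _

theorem map_apply_eq_of_apply_eq (f : G.LocalSection U V) (f' : G.LocalSection U' V') {x : U}
    {x' : U'} (h : f.toFun x = f'.toFun x') :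
    LocalSection.toFun (Φ.map f) x = LocalSection.toFun (Φ.map f') x' := by
  obtain ⟨x, hx⟩ := x
  obtain ⟨x', hx'⟩ := x'
  obtain rfl : x = x' := (f.src_toFun _).symm.trans ((congrArg G.src h).trans (f'.src_toFun _))
  obtain ⟨W, hW, i, i', e⟩ := f.exists_eqOn f' hx hx' h
  -- The targets `V` and `V'` may differ. Enlarging both to `⊤` makes the two restrictions to `W`
  -- the same morphism, and changes no value of `Φ`.
  have key {U V : Opens X} (f : G.LocalSection U V) (i : W ≤ U) (y : W) :
      LocalSection.toFun (Φ.map (G.localSections.comp (f.restrict i)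
        (G.localSections.incl le_top))) y = LocalSection.toFun (Φ.map f) ⟨y, i y.2⟩ := by
    rw [map_comp_incl_apply, map_restrict]
    rfl
  rw [← key f i ⟨x, hW⟩, ← key f' i' ⟨x, hW⟩]
  have e' : G.localSections.comp (f.restrict i) (G.localSections.incl le_top) =
      G.localSections.comp (f'.restrict i') (G.localSections.incl (le_top : V' ≤ ⊤)) := by
    refine LocalSection.ext (funext fun y => ?_)
    rw [LocalSection.comp_incl_apply, LocalSection.comp_incl_apply]
    exact e y
  rw [e']

/-- The action on arrows of a functor between the categories of local sections: the arrow `f x` is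
sent to `Φ f x`, for every local section `f`. -/
noncomputable def arrowMap (a : G.Arr) : H.Arr :=
  LocalSection.toFun
    (Φ.map (G.exists_localSection rfl (V := ⊤) trivial).choose_spec.choose_spec.choose)
    ⟨G.src a, (G.exists_localSection rfl (V := ⊤) trivial).choose_spec.choose⟩

theorem arrowMap_apply (f : G.LocalSection U V) (x : U) :
    arrowMap Φ (f.toFun x) = LocalSection.toFun (Φ.map f) x :=
  map_apply_eq_of_apply_eq Φ _ f
    (G.exists_localSection rfl (V := ⊤) trivial).choose_spec.choose_spec.choose_spec

theorem src_arrowMap (a : G.Arr) : H.src (arrowMap Φ a) = G.src a :=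
  LocalSection.src_toFun _ _

/-- For each open `O` around the target of `a`, a section through `a` can be chosen with targets in
`O`; `Φ` preserves `O`, and T₁ concludes. -/
theorem tgt_arrowMap [T1Space X] (a : G.Arr) : H.tgt (arrowMap Φ a) = G.tgt a := by
  refine Specializes.eq (specializes_iff_forall_open.2 fun O hO ha => ?_)
  obtain ⟨U, f, x, rfl⟩ := exists_localSection_apply_eq a (V := ⟨O, hO⟩) ha
  rw [arrowMap_apply]
  exact LocalSection.tgt_mem (Φ.map f) _

/-- A section of a local homeomorphism is an open embedding, so continuity can be tested after
composing with `f`, where `arrowMap Φ` becomes the continuous map `Φ.map f`. -/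
theorem continuous_arrowMap : Continuous (arrowMap Φ) := by
  refine continuous_iff_continuousAt.2 fun a => ?_
  obtain ⟨U, f, x, hf⟩ := exists_localSection_apply_eq a (V := ⊤) trivial
  have hs : Topology.IsOpenEmbedding f.toFun := by
    refine G.src_isLocalHomeomorph.isOpenEmbedding_of_comp ?_ f.continuous_toFun
    have : G.src ∘ f.toFun = Subtype.val := funext f.src_toFun
    rw [this]
    exact U.isOpenEmbedding'
  rw [← hf, hs.continuousAt_iff.symm]
  refine (LocalSection.continuous_toFun (Φ.map f)).continuousAt.congr (.of_forall fun x => ?_)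
  exact (arrowMap_apply Φ f x).symm

/-- The morphism of étale groupoids determined by a functor between the categories of local
sections. -/
noncomputable def homOfFun [T1Space X] : G ⟶ H where
  toFun := arrowMap Φ
  continuous_toFun := continuous_arrowMap Φ
  src_toFun := src_arrowMap Φ
  tgt_toFun := tgt_arrowMap Φ
  toFun_one x := by
    refine (arrowMap_apply Φ (G.localSections.id ⊤) ⟨x, trivial⟩).trans ?_
    rw [Φ.map_id]
    rfl
  toFun_mul g f h := by
    -- The section through `g` is chosen before the one through `f`, so that the latter can be
    -- required to have targets in its domain `V`.
    obtain ⟨V, hV, g', hg⟩ := G.exists_localSection (a := g) h (V := ⊤) trivial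
    obtain ⟨U, f', x, rfl⟩ := exists_localSection_apply_eq f hV
    obtain rfl : g'.toFun ⟨G.tgt (f'.toFun x), hV⟩ = g := hg
    refine (arrowMap_apply Φ (G.localSections.comp f' g') x).trans ?_
    refine (congrArg (fun k => LocalSection.toFun k x) (Φ.map_comp f' g')).trans ?_
    refine H.mul_congr ?_ (arrowMap_apply Φ f' _).symm _
    rw [arrowMap_apply]
    refine LocalSection.apply_congr (Φ.map g') ?_
    exact (congrArg H.tgt (arrowMap_apply Φ f' _)).symm.trans (tgt_arrowMap Φ _)

end Functor

instance : (localSectionsFunctor X).Faithful where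
  map_injective {G H} φ ψ h := by
    refine Hom.ext (funext fun a => ?_)
    obtain ⟨U, f, x, rfl⟩ := exists_localSection_apply_eq a (V := ⊤) trivial
    have h' := congrArg (fun Φ : OpensCat.Fun G.localSections H.localSections => Φ.map f) h
    exact congrArg (fun k : H.LocalSection U ⊤ => k.toFun x) h'

instance [T1Space X] : (localSectionsFunctor X).Full where
  map_surjective Φ := ⟨homOfFun Φ, OpensCat.Fun.ext (funext fun _ => funext fun _ =>
    funext fun f => LocalSection.ext (funext fun x => arrowMap_apply Φ f x))⟩

end EtaleGroupoid

/-! ### The arrows of `C*` and their germ topology. -/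

namespace OpensCat

variable {X : TopCat.{u}} {C : OpensCat X}

variable (C) in
/-- The arrows of `C*`. -/
structure Arrow where
  src : X
  tgt : X
  hom : C.StarHom src tgt

namespace Arrow

variable {U U' V V' W : Opens X} {a b : C.Arrow}

/-- The arrow `a` of `C*` is represented at its source by the morphism `f` of `C`. -/
def IsGerm (a : C.Arrow) (f : C.Hom U V) : Prop :=
  ∃ (hU : a.src ∈ U) (hV : a.tgt ∈ V), a.hom.proj V hV = C.germ a.src hU f

/-- The identity of `x` in `C*`. -/
noncomputable def one (x : X) : C.Arrow := ⟨x, x, StarHom.id x⟩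

/-- Composition in `C*`. -/
noncomputable def mul (b a : C.Arrow) (h : b.src = a.tgt) : C.Arrow :=
  ⟨a.src, b.tgt, a.hom.comp (h ▸ b.hom)⟩

/-- Inversion in `C*`. -/
noncomputable def inv (hC : C.IsPrePseudogroup) (a : C.Arrow) : C.Arrow :=
  ⟨a.tgt, a.src, @CategoryTheory.inv C.Star _ a.src a.tgt a.hom (hC.isGroupoid.all_isIso _)⟩

theorem exists_isGerm (a : C.Arrow) (hV : a.tgt ∈ V) :
    ∃ (U : Opens X) (f : C.Hom U V), a.IsGerm f := by
  obtain ⟨U, hU, f, hf⟩ := C.exists_germ (a.hom.proj V hV)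
  exact ⟨U, f, hU, hV, hf.symm⟩

/-- The surjectivity half of the coproduct condition. -/
theorem exists_src_eq_isGerm (hC : C.IsPrePseudogroup) (f : C.Hom U V) {x : X} (hx : x ∈ U) :
    ∃ a : C.Arrow, a.src = x ∧ a.IsGerm f := by
  obtain ⟨⟨y, a⟩, h⟩ := (hC.bijective_proj x V).2 (C.germ x hx f)
  exact ⟨⟨x, y, a⟩, rfl, hx, y.2, h⟩

/-- The injectivity half of the coproduct condition: a germ also determines the target of the arrow.
-/
theorem IsGerm.eq_of_src_eq (hC : C.IsPrePseudogroup) {f : C.Hom U V} (ha : a.IsGerm f)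
    (hb : b.IsGerm f) (h : a.src = b.src) : a = b := by
  obtain ⟨x, y, a⟩ := a
  obtain ⟨x', y', b⟩ := b
  obtain rfl : x = x' := h
  obtain ⟨hU, hV, ha⟩ := ha
  obtain ⟨hU', hV', hb⟩ := hb
  have key := @(hC.bijective_proj x V).1 ⟨⟨y, hV⟩, a⟩ ⟨⟨y', hV'⟩, b⟩ (ha.trans hb.symm)
  obtain ⟨h₁, h₂⟩ := Sigma.mk.inj_iff.1 key
  obtain rfl : y = y' := congrArg Subtype.val h₁
  rw [eq_of_heq h₂]

theorem isGerm_incl_comp_iff {f : C.Hom U V} (h : U' ≤ U) :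
    a.IsGerm (C.comp (C.incl h) f) ↔ a.src ∈ U' ∧ a.IsGerm f := by
  constructor
  · rintro ⟨hU, hV, e⟩
    exact ⟨hU, h hU, hV, e.trans (C.germ_incl_comp h hU f)⟩
  · rintro ⟨hU, hU', hV, e⟩
    exact ⟨hU, hV, e.trans (C.germ_incl_comp h hU f).symm⟩

theorem IsGerm.comp_incl {f : C.Hom U V} (ha : a.IsGerm f) (h : V ≤ W) :
    a.IsGerm (C.comp f (C.incl h)) := by
  obtain ⟨hU, hV, e⟩ := ha
  exact ⟨hU, h hV, by rw [← a.hom.map_proj h hV, e, stalkMap_germ]⟩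

theorem IsGerm.mul {f : C.Hom U V} {g : C.Hom V W} (hb : b.IsGerm g) (ha : a.IsGerm f)
    (h : b.src = a.tgt) : (b.mul a h).IsGerm (C.comp f g) := by
  obtain ⟨x, y, a⟩ := a
  obtain ⟨y', z, b⟩ := b
  obtain rfl : y' = y := h
  obtain ⟨hU, hV, ha⟩ := ha
  obtain ⟨hV', hW, hb⟩ := hb
  refine ⟨hU, hW, ?_⟩
  change a.precomp W (b.proj W hW) = C.germ x hU (C.comp f g)
  rw [hb, StarHom.precomp_germ]
  exact (congrArg _ ha).trans (C.stalkMap_germ hU f g)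

theorem isGerm_one {x : X} (hx : x ∈ U) (h : U ≤ V) : (one x : C.Arrow).IsGerm (C.incl h) := by
  refine ⟨hx, h hx, ?_⟩
  rw [← C.comp_id (C.incl h)]
  exact (C.germ_incl_comp h hx (C.id V)).symm

/-- Two morphisms representing the same arrow represent the same arrows nearby. -/
theorem IsGerm.exists_forall_iff {f : C.Hom U V} {f' : C.Hom U' V} (hf : a.IsGerm f)
    (hf' : a.IsGerm f') :
    ∃ W : Opens X, a.src ∈ W ∧ ∀ b : C.Arrow, b.src ∈ W → (b.IsGerm f ↔ b.IsGerm f') := by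
  obtain ⟨hU, hV, e⟩ := hf
  obtain ⟨hU', hV', e'⟩ := hf'
  obtain ⟨W, hW, i, i', h⟩ := exists_incl_comp_eq_of_germ_eq (e.symm.trans e')
  refine ⟨W, hW, fun b hb => ?_⟩
  have := isGerm_incl_comp_iff (a := b) (f := f) i
  rw [h, isGerm_incl_comp_iff] at this
  simpa [hb] using this.symm

/-- This makes the germ sets a basis. Since `V` and `V'` may differ, `a` is represented by some `k`
into `V ⊓ V'`, which is compared with `f` inside `V` and with `f'` inside `V'`, then restricted. -/
theorem IsGerm.exists_forall_and {f : C.Hom U V} {f' : C.Hom U' V'} (hf : a.IsGerm f)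
    (hf' : a.IsGerm f') :
    ∃ (W : Opens X) (k : C.Hom W (V ⊓ V')), a.IsGerm k ∧
      ∀ b : C.Arrow, b.IsGerm k → b.IsGerm f ∧ b.IsGerm f' := by
  obtain ⟨W, k, hk⟩ := a.exists_isGerm (V := V ⊓ V') ⟨hf.2.1, hf'.2.1⟩
  obtain ⟨W₁, h₁, e₁⟩ := (hk.comp_incl inf_le_left).exists_forall_iff hf
  obtain ⟨W₂, h₂, e₂⟩ := (hk.comp_incl inf_le_right).exists_forall_iff hf'
  refine ⟨W ⊓ (W₁ ⊓ W₂), C.comp (C.incl inf_le_left) k,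
    (isGerm_incl_comp_iff _).2 ⟨⟨hk.1, h₁, h₂⟩, hk⟩, fun b hb => ?_⟩
  obtain ⟨hW, hb⟩ := (isGerm_incl_comp_iff _).1 hb
  exact ⟨(e₁ b hW.2.1).1 (hb.comp_incl _), (e₂ b hW.2.2).1 (hb.comp_incl _)⟩

/-- The germ topology: a basis of open sets is given by the sets of all arrows represented by some
morphism of `C`. -/
instance : TopologicalSpace C.Arrow :=
  generateFrom {S | ∃ (U V : Opens X) (f : C.Hom U V), {a : C.Arrow | a.IsGerm f} = S}

theorem isOpen_setOf_isGerm (f : C.Hom U V) : IsOpen {a : C.Arrow | a.IsGerm f} :=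
  isOpen_generateFrom_of_mem ⟨U, V, f, rfl⟩

variable (C) in
theorem isTopologicalBasis_setOf_isGerm : IsTopologicalBasis
    {S | ∃ (U V : Opens X) (f : C.Hom U V), {a : C.Arrow | a.IsGerm f} = S} where
  exists_subset_inter := by
    rintro _ ⟨U, V, f, rfl⟩ _ ⟨U', V', f', rfl⟩ a ⟨hf, hf'⟩
    obtain ⟨W, k, hk, h⟩ := IsGerm.exists_forall_and hf hf'
    exact ⟨_, ⟨_, _, k, rfl⟩, hk, h⟩
  sUnion_eq := by
    refine Set.eq_univ_of_forall fun a => ?_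
    obtain ⟨U, f, hf⟩ := a.exists_isGerm (V := ⊤) trivial
    exact ⟨_, ⟨_, _, f, rfl⟩, hf⟩
  eq_generateFrom := rfl

theorem continuous_src : Continuous (src : C.Arrow → X) := by
  refine continuous_def.2 fun O hO => isOpen_iff_forall_mem_open.2 fun a ha => ?_
  obtain ⟨U, f, hf⟩ := a.exists_isGerm (V := ⊤) trivial
  refine ⟨_, ?_, isOpen_setOf_isGerm
    (C.comp (C.incl (inf_le_left : U ⊓ ⟨O, hO⟩ ≤ U)) f), ?_⟩
  · exact fun b hb => ((isGerm_incl_comp_iff _).1 hb).1.2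
  · exact (isGerm_incl_comp_iff _).2 ⟨⟨hf.1, ha⟩, hf⟩

theorem eventually_src_mem {W : Opens X} (hW : a.src ∈ W) : ∀ᶠ b in nhds a, b.src ∈ W :=
  continuous_src.continuousAt.eventually (W.isOpen.mem_nhds hW)

theorem IsGerm.eventually {f : C.Hom U V} (h : a.IsGerm f) : ∀ᶠ b in nhds a, b.IsGerm f :=
  (isOpen_setOf_isGerm f).mem_nhds h

/-- By the coproduct condition, `src` maps the open set of germs of `f : U ⟶ V` bijectively onto
`U`. -/
theorem isLocalHomeomorph_src (hC : C.IsPrePseudogroup) :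
    IsLocalHomeomorph (src : C.Arrow → X) := by
  have ho : IsOpenMap (src : C.Arrow → X) := by
    refine (isTopologicalBasis_setOf_isGerm C).isOpenMap_iff.2 ?_
    rintro _ ⟨U, V, f, rfl⟩
    convert U.isOpen
    ext x
    constructor
    · rintro ⟨a, ha, rfl⟩
      exact ha.1
    · intro hx
      obtain ⟨a, rfl, ha⟩ := exists_src_eq_isGerm hC f hx
      exact ⟨a, ha, rfl⟩
  refine isLocalHomeomorph_iff_isOpenEmbedding_restrict.2 fun a => ?_
  obtain ⟨U, f, hf⟩ := a.exists_isGerm (V := ⊤) trivial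
  refine ⟨_, hf.eventually, .of_continuous_injective_isOpenMap
    (continuous_src.comp continuous_subtype_val) ?_ ?_⟩
  · rintro ⟨b, hb⟩ ⟨c, hc⟩ h
    exact Subtype.ext (IsGerm.eq_of_src_eq hC hb hc h)
  · exact ho.comp (isOpen_setOf_isGerm f).isOpenMap_subtype_val

theorem continuous_of_eventually_isGerm {Y : Type*} [TopologicalSpace Y] {F : Y → C.Arrow}
    (h : ∀ y, ∀ (U V : Opens X) (f : C.Hom U V), (F y).IsGerm f →
      ∀ᶠ z in nhds y, (F z).IsGerm f) : Continuous F := by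
  refine continuous_generateFrom_iff.2 ?_
  rintro _ ⟨U, V, f, rfl⟩
  exact isOpen_iff_mem_nhds.2 fun y hy => h y U V f hy

theorem continuous_one : Continuous (one : X → C.Arrow) := by
  refine continuous_of_eventually_isGerm fun x U V f hf => ?_
  obtain ⟨W, hW, h⟩ := (isGerm_one (C := C) hf.2.1 le_rfl).exists_forall_iff hf
  filter_upwards [(W ⊓ V).isOpen.mem_nhds ⟨hW, hf.2.1⟩] with z hz
  exact (h _ hz.1).1 (isGerm_one hz.2 _)

theorem inv_mul (hC : C.IsPrePseudogroup) (a : C.Arrow) : (a.inv hC).mul a rfl = one a.src := by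
  exact congrArg (Arrow.mk a.src a.src)
    (@IsIso.hom_inv_id C.Star _ a.src a.tgt a.hom (hC.isGroupoid.all_isIso _))

theorem mul_inv (hC : C.IsPrePseudogroup) (a : C.Arrow) : a.mul (a.inv hC) rfl = one a.tgt := by
  exact congrArg (Arrow.mk a.tgt a.tgt)
    (@IsIso.inv_hom_id C.Star _ a.src a.tgt a.hom (hC.isGroupoid.all_isIso _))

theorem mul_one (a : C.Arrow) (h : a.src = (one a.src : C.Arrow).tgt) :
    a.mul (one a.src) h = a :=
  congrArg (Arrow.mk a.src a.tgt) a.hom.id_comp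

theorem one_mul (a : C.Arrow) (h : (one a.tgt : C.Arrow).src = a.tgt) :
    (one a.tgt).mul a h = a :=
  congrArg (Arrow.mk a.src a.tgt) a.hom.comp_id

theorem mul_assoc (c b a : C.Arrow) (h₁ : c.src = b.tgt) (h₂ : b.src = a.tgt) :
    (c.mul b h₁).mul a h₂ = c.mul (b.mul a h₂) h₁ := by
  obtain ⟨w, x, a⟩ := a
  obtain ⟨x', y, b⟩ := b
  obtain ⟨y', z, c⟩ := c
  obtain rfl : x' = x := h₂
  obtain rfl : y' = y := h₁
  exact congrArg (Arrow.mk w z) (a.assoc b c).symm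

theorem mul_congr {b b' a a' : C.Arrow} (hb : b = b') (ha : a = a') (h : b.src = a.tgt) :
    b.mul a h = b'.mul a' (hb ▸ ha ▸ h) := by
  subst hb ha
  rfl

/-- Uniqueness of left inverses; it lets `continuous_inv` recognise an inverse from its germ. -/
theorem eq_inv_of_mul_eq_one (hC : C.IsPrePseudogroup) (h : b.src = a.tgt)
    (e : b.mul a h = one a.src) : b = a.inv hC := by
  have h₁ : (b.mul a h).mul (a.inv hC) rfl = a.inv hC :=
    (mul_congr e rfl _).trans (one_mul (a.inv hC) rfl)
  have h₂ : b.mul (a.mul (a.inv hC) rfl) h = b :=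
    (mul_congr rfl ((mul_inv hC a).trans (congrArg one h.symm)) _).trans (mul_one b rfl)
  exact h₂.symm.trans ((mul_assoc b a (a.inv hC) h rfl).symm.trans h₁)

theorem inv_inv (hC : C.IsPrePseudogroup) (a : C.Arrow) : (a.inv hC).inv hC = a :=
  (eq_inv_of_mul_eq_one hC rfl (mul_inv hC a)).symm

/-- If `f` represents `a` and `g` its inverse, then `g ∘ f` represents an identity, so it agrees
with an inclusion near the source of `a`. For `b` near `a`, the germ of `g` at the target of `b` is
therefore a left inverse of `b`, that is, its inverse. -/
theorem continuous_inv (hC : C.IsPrePseudogroup) : Continuous (inv hC : C.Arrow → C.Arrow) := by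
  refine continuous_of_eventually_isGerm fun a V W g hg => ?_
  obtain ⟨U, f, hf⟩ := a.exists_isGerm (V := V) hg.1
  have h₁ : (one a.src : C.Arrow).IsGerm (C.comp f g) := inv_mul hC a ▸ hg.mul hf rfl
  have h₂ : (one a.src : C.Arrow).IsGerm (C.incl (inf_le_right : U ⊓ W ≤ W)) :=
    isGerm_one (U := U ⊓ W) ⟨hf.1, hg.2.1⟩ _
  obtain ⟨O, hO, e⟩ := h₁.exists_forall_iff h₂
  filter_upwards [hf.eventually, eventually_src_mem hO,
    eventually_src_mem (a := a) (W := U ⊓ W) ⟨hf.1, hg.2.1⟩] with b hb hbO hbW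
  obtain ⟨c, hcb, hc⟩ := exists_src_eq_isGerm hC g hb.2.1
  have h₃ : c.mul b hcb = one b.src :=
    (hc.mul hb hcb).eq_of_src_eq hC ((e (one b.src) hbO).2 (isGerm_one hbW _)) rfl
  rwa [← eq_inv_of_mul_eq_one hC hcb h₃]

theorem continuous_mul : Continuous fun p : {p : C.Arrow × C.Arrow // p.1.src = p.2.tgt} =>
    p.1.1.mul p.1.2 p.2 := by
  refine continuous_of_eventually_isGerm ?_
  rintro ⟨⟨b, a⟩, h : b.src = a.tgt⟩ U W k hk
  -- Representatives are chosen from the left, `f` landing in the domain of `g`. The composite has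
  -- the same target `W` as `k`, so both have the same germs near the source of `a`.
  obtain ⟨V, g, hg⟩ := b.exists_isGerm (V := W) hk.2.1
  obtain ⟨U', f, hf⟩ := a.exists_isGerm (V := V) (h ▸ hg.1)
  obtain ⟨O, hO, e⟩ := (hg.mul hf h).exists_forall_iff hk
  have ha : Filter.Tendsto
      (fun p : {p : C.Arrow × C.Arrow // p.1.src = p.2.tgt} => p.1.2) (nhds ⟨⟨b, a⟩, h⟩) (nhds a) :=
    (continuous_snd.comp continuous_subtype_val).continuousAt
  have hb : Filter.Tendsto
      (fun p : {p : C.Arrow × C.Arrow // p.1.src = p.2.tgt} => p.1.1) (nhds ⟨⟨b, a⟩, h⟩) (nhds b) :=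
    (continuous_fst.comp continuous_subtype_val).continuousAt
  filter_upwards [ha.eventually hf.eventually, hb.eventually hg.eventually,
    ha.eventually (eventually_src_mem hO)] with p hpf hpg hpO
  exact (e (p.1.1.mul p.1.2 p.2) hpO).1 (hpg.mul hpf p.2)

end Arrow

end OpensCat

/-! ### The germ groupoid and the comparison of `C` with its local sections. -/

namespace OpensCat

variable {X : TopCat.{u}} {C : OpensCat X}

/-- The étale groupoid of germs of a pre-pseudogroup. -/
noncomputable def IsPrePseudogroup.germGroupoid (hC : C.IsPrePseudogroup) : EtaleGroupoid X where
  Arr := C.Arrow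
  src := Arrow.src
  tgt := Arrow.tgt
  one := Arrow.one
  inv := Arrow.inv hC
  mul := Arrow.mul
  src_one _ := rfl
  tgt_one _ := rfl
  src_inv _ := rfl
  tgt_inv _ := rfl
  src_mul _ _ _ := rfl
  tgt_mul _ _ _ := rfl
  mul_one f := f.mul_one _
  one_mul f := f.one_mul _
  mul_assoc := Arrow.mul_assoc
  inv_mul := Arrow.inv_mul hC
  mul_inv := Arrow.mul_inv hC
  src_isLocalHomeomorph := Arrow.isLocalHomeomorph_src hC
  -- The target map is `src` composed with inversion, which is a homeomorphism.
  tgt_isLocalHomeomorph := (Arrow.isLocalHomeomorph_src hC).comp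
    (Homeomorph.isLocalHomeomorph
      { toFun := Arrow.inv hC
        invFun := Arrow.inv hC
        left_inv := Arrow.inv_inv hC
        right_inv := Arrow.inv_inv hC
        continuous_toFun := Arrow.continuous_inv hC
        continuous_invFun := Arrow.continuous_inv hC })
  continuous_one := Arrow.continuous_one
  continuous_inv := Arrow.continuous_inv hC
  continuous_mul := Arrow.continuous_mul

variable {U V W : Opens X}

/-- The arrow of `C*` represented by `f` at `x`. -/
noncomputable def arrowAt (hC : C.IsPrePseudogroup) (f : C.Hom U V) (x : U) : C.Arrow :=
  (Arrow.exists_src_eq_isGerm hC f x.2).choose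

theorem src_arrowAt (hC : C.IsPrePseudogroup) (f : C.Hom U V) (x : U) :
    (arrowAt hC f x).src = x :=
  (Arrow.exists_src_eq_isGerm hC f x.2).choose_spec.1

theorem isGerm_arrowAt (hC : C.IsPrePseudogroup) (f : C.Hom U V) (x : U) :
    (arrowAt hC f x).IsGerm f :=
  (Arrow.exists_src_eq_isGerm hC f x.2).choose_spec.2

theorem arrowAt_eq (hC : C.IsPrePseudogroup) {f : C.Hom U V} {x : U} {a : C.Arrow}
    (h : a.src = x) (ha : a.IsGerm f) : arrowAt hC f x = a :=
  (isGerm_arrowAt hC f x).eq_of_src_eq hC ha ((src_arrowAt hC f x).trans h.symm)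

/-- A common refinement `k` of `f` and `g` at `x` has, at each nearby `y`, a germ that is both the
germ of `f` and represented by `g`. -/
theorem continuous_arrowAt (hC : C.IsPrePseudogroup) (f : C.Hom U V) :
    Continuous (arrowAt hC f) := by
  refine Arrow.continuous_of_eventually_isGerm fun x U' V' g hg => ?_
  obtain ⟨W, k, hk, h⟩ := (isGerm_arrowAt hC f x).exists_forall_and hg
  have hx : (x : X) ∈ W := src_arrowAt hC f x ▸ hk.1
  filter_upwards [continuous_subtype_val.continuousAt.eventually (W.isOpen.mem_nhds hx)] with y hy
  obtain ⟨b, hby, hb⟩ := Arrow.exists_src_eq_isGerm hC k hy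
  rw [arrowAt_eq hC hby (h b hb).1]
  exact (h b hb).2

/-- The functor which sends a morphism of `C` to the local section formed by its germs. -/
noncomputable def toLocalSections (hC : C.IsPrePseudogroup) :
    C ⟶ hC.germGroupoid.localSections where
  map f :=
    { toFun := arrowAt hC f
      continuous_toFun := continuous_arrowAt hC f
      src_toFun := src_arrowAt hC f
      tgt_mem := fun x => (isGerm_arrowAt hC f x).2.1 }
  map_id U := EtaleGroupoid.LocalSection.ext (funext fun x =>
    arrowAt_eq hC (a := .one x) rfl (C.incl_refl U ▸ Arrow.isGerm_one x.2 le_rfl))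
  map_comp f g := EtaleGroupoid.LocalSection.ext (funext fun x =>
    arrowAt_eq hC (src_arrowAt hC f x) ((isGerm_arrowAt hC g _).mul (isGerm_arrowAt hC f x)
      (src_arrowAt hC g ⟨_, (isGerm_arrowAt hC f x).2.1⟩)))
  map_incl h := EtaleGroupoid.LocalSection.ext (funext fun x =>
    arrowAt_eq hC (a := .one x) rfl (Arrow.isGerm_one x.2 h))

theorem Arrow.IsGerm.germ_eq {a : C.Arrow} {U' : Opens X} {f : C.Hom U V} {f' : C.Hom U' V}
    (hf : a.IsGerm f) (hf' : a.IsGerm f') {x : X} (hx : a.src = x) :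
    C.germ x (hx ▸ hf.1) f = C.germ x (hx ▸ hf'.1) f' := by
  subst hx
  exact hf.2.2.symm.trans hf'.2.2

/-- Injectivity is separatedness: a morphism is determined by its germs. Surjectivity is gluing: a
continuous section is locally the family of germs of one morphism. -/
theorem toLocalSections_bijective (hC : C.IsPseudogroupSheaf) (U V : Opens X) :
    Function.Bijective ((toLocalSections hC.toIsPrePseudogroup).map : C.Hom U V → _) := by
  have hC' := hC.toIsPrePseudogroup
  constructor
  · intro f f' h
    refine hom_ext_of_germ_eq (hC.isSheaf V) fun x hx => ?_
    have e : arrowAt hC' f ⟨x, hx⟩ = arrowAt hC' f' ⟨x, hx⟩ :=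
      congrArg (fun k : hC'.germGroupoid.LocalSection U V => k.toFun ⟨x, hx⟩) h
    exact (isGerm_arrowAt hC' f ⟨x, hx⟩).germ_eq (e ▸ isGerm_arrowAt hC' f' ⟨x, hx⟩)
      (src_arrowAt hC' f ⟨x, hx⟩)
  · intro σ
    let s : U → C.Arrow := EtaleGroupoid.LocalSection.toFun σ
    have hsrc (x : U) : (s x).src = x := EtaleGroupoid.LocalSection.src_toFun σ x
    have hloc (x : U) : ∃ (W : Opens X) (_ : (x : X) ∈ W) (hW : W ≤ U) (f : C.Hom W V),
        ∀ y : W, (s ⟨y, hW y.2⟩).IsGerm f := by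
      obtain ⟨U', f, hf⟩ := (s x).exists_isGerm (EtaleGroupoid.LocalSection.tgt_mem σ x)
      -- Continuity of `σ` for the germ topology enters here: near `x`, all values of `σ` are germs
      -- of the single `f`.
      have ho : IsOpen (s ⁻¹' {a | a.IsGerm f}) :=
        (Arrow.isOpen_setOf_isGerm f).preimage (EtaleGroupoid.LocalSection.continuous_toFun σ)
      let W : Opens X := ⟨_, U.isOpen.isOpenMap_subtype_val _ ho⟩
      have hW : W ≤ U' := by
        rintro _ ⟨y, hy, rfl⟩
        have h : (s y).IsGerm f := hy
        exact hsrc y ▸ h.1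
      refine ⟨W, ⟨x, hf, rfl⟩, ?_, C.comp (C.incl hW) f, ?_⟩
      · rintro _ ⟨y, -, rfl⟩
        exact y.2
      · rintro ⟨_, y, hy, rfl⟩
        exact (Arrow.isGerm_incl_comp_iff hW).2 ⟨(hsrc y).symm ▸ ⟨y, hy, rfl⟩, hy⟩
    choose W hxW hW f hf using hloc
    obtain ⟨g, hg⟩ := exists_gluing (hC.isSheaf V) W hW
      (fun x hx => Opens.mem_iSup.2 ⟨⟨x, hx⟩, hxW _⟩) f fun i j => by
        -- On overlaps the two morphisms have equal germs, since both represent the arrow that `σ`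
        -- takes at `x`.
        refine hom_ext_of_germ_eq (hC.isSheaf V) fun x hx => ?_
        rw [germ_incl_comp, germ_incl_comp]
        exact (hf i ⟨x, hx.1⟩).germ_eq (hf j ⟨x, hx.2⟩) (hsrc _)
    refine ⟨g, EtaleGroupoid.LocalSection.ext (funext fun x => ?_)⟩
    refine arrowAt_eq hC' (hsrc x) ((Arrow.isGerm_incl_comp_iff (hW x)).1 ?_).2
    rw [hg]
    exact hf x ⟨x, hxW x⟩

end OpensCat

/-! ### The equivalence of categories. -/

theorem theorem4p2 (X : TopCat.{u}) [T1Space X] :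
    ∃ e : EtaleGroupoid X ≌ PseudogroupSheaf X,
      Nonempty (e.functor ⋙ (pseudogroupSheafProperty X).ι ≅
        EtaleGroupoid.localSectionsFunctor X) := by
  have hP (G : EtaleGroupoid X) : G.localSections.IsPseudogroupSheaf :=
    G.isPseudogroupSheaf_localSections
  let F : EtaleGroupoid X ⥤ PseudogroupSheaf X :=
    (pseudogroupSheafProperty X).lift (EtaleGroupoid.localSectionsFunctor X) hP
  have : F.Faithful := .of_comp_iso ((pseudogroupSheafProperty X).liftCompιIso _ hP)
  have : F.Full := .of_comp_faithful_iso ((pseudogroupSheafProperty X).liftCompιIso _ hP)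
  have : F.EssSurj := ⟨fun C => ⟨C.property.toIsPrePseudogroup.germGroupoid,
    ⟨(ObjectProperty.isoMk _ (OpensCat.isoOfBijective _
      (OpensCat.toLocalSections_bijective C.property))).symm⟩⟩⟩
  have : F.IsEquivalence := { }
  -- Forgetting the sheaf property after lifting gives back the local sections functor by
  -- definition.
  exact ⟨F.asEquivalence, ⟨Iso.refl _⟩⟩
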